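/- Let $M$ be a compact connected 3-dimensional manifold with a finite triangulation $\mathcal T$, with vertex set $V=\{1,\dots,N\}$ and set of tetrahedra $T$ (4-element subsets of $V$). A sphere packing metric is a vector $r\in\mathbb R^N_{>0}$ such that for every tetrahedron $\{i,j,k,l\}\in T$ $$\Big(\tfrac1{r_i}+\tfrac1{r_j}+\tfrac1{r_k}+\tfrac1{r_l}\Big)^2-2\Big(\tfrac1{r_i^2}+\tfrac1{r_j^2}+\tfrac1{r_k^2}+\tfrac1{r_l^2}\Big)>0,$$ i.e. such that the edge lengths $l_{ij}=r_i+r_j$ make every tetrahedron a nondegenerate Euclidean tetrahedron. Let $K_i=4\pi-\sum_{\{i,j,k,l\}\in T}\alpha_{ijkl}$, where $\alpha_{ijkl}$ is the solid angle at $i$ of the Euclidean tetrahedron $\{i,j,k,l\}$ with these edge lengths. For $\alpha\in\mathbb R$ put $$s_\alpha(r)=\frac{\sum_{i}K_ir_i}{\sum_i r_i^{\alpha+1}},\qquad \Gamma_i(r)=s_\alpha r_i^\alpha-K_i,\qquad (\Delta_\alpha f)_i=\frac1{r_i^\alpha}\sum_{j\sim i}\Big(-\frac{\partial K_i}{\partial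 r_j}r_j\Big)(f_j-f_i)\quad (f\in\mathbb R^N),$$ where $j\sim i$ means that $\{i,j\}$ is an edge; $\Gamma$ is the vector field of the $\alpha$-flow $\dot r=\Gamma(r)$. Suppose $r^*$ is a sphere packing metric of constant $\alpha$-curvature, i.e. $K_i/r_i^\alpha$ has the same value at all vertices $i$ when $r=r^*$. If the first (smallest) positive eigenvalue $\lambda_1(-\Delta_\alpha)$ of $-\Delta_\alpha$ at $r^*$ satisfies $$\lambda_1(-\Delta_\alpha)>\alpha\, s_\alpha(r^*),$$ then $\Gamma$ is differentiable at $r^*$ and the negative Jacobian matrix $-D\Gamma|_{r^*}$ is (symmetric) positive semidefinite, of rank $N-1$, with kernel $\{t r^*: t\in\mathbb R\}$. -/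

import Mathlib

open scoped Matrix

noncomputable section

/-- The geometric realization, in barycentric coordinates, of the abstract simplicial complex
whose maximal simplices are the members of `tets`: nonnegative weights on the vertices, of total
weight one, supported on some member of `tets`. -/
def geometricRealization {V : Type*} [Fintype V] (tets : Finset (Finset V)) : Set (V → ℝ) :=
  {x | (∀ v, 0 ≤ x v) ∧ ∑ v, x v = 1 ∧ ∃ t ∈ tets, ∀ v, v ∉ t → x v = 0}

/-- A finite triangulation, with vertex set `V`, of a 3-dimensional space `M`. The tetrahedra are
4-element sets of vertices; the edges and the triangles are the subsets of the tetrahedra with two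
and three elements. -/
structure Triangulation (V : Type*) [Fintype V] [DecidableEq V]
    (M : Type*) [TopologicalSpace M] where
  tets : Finset (Finset V)
  card_tet : ∀ t ∈ tets, t.card = 4
  exists_tet : ∀ v : V, ∃ t ∈ tets, v ∈ t
  homeo : geometricRealization tets ≃ₜ M

section Tetrahedron

variable {V : Type*}

/-- The length `l_ij = r_i + r_j` of the edge joining two distinct vertices. -/
def edgeLength (r : V → ℝ) (i j : V) : ℝ := r i + r j

/-- The angle at `i` of the Euclidean triangle `ijk` with the given edge lengths
(law of cosines). -/
def faceAngle (r : V → ℝ) (i j k : V) : ℝ :=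
  Real.arccos ((edgeLength r i j ^ 2 + edgeLength r i k ^ 2 - edgeLength r j k ^ 2) /
    (2 * edgeLength r i j * edgeLength r i k))

/-- The interior dihedral angle, along the edge `ij`, of the Euclidean tetrahedron `ijkl` with the
given edge lengths, obtained from the three face angles at `i` (spherical law of cosines).
See `dihedralAngle_eq_angle` for the comparison with the angle between the two half-planes. -/
def dihedralAngle (r : V → ℝ) (i j k l : V) : ℝ :=
  Real.arccos ((Real.cos (faceAngle r i k l) -
      Real.cos (faceAngle r i j k) * Real.cos (faceAngle r i j l)) /
    (Real.sin (faceAngle r i j k) * Real.sin (faceAngle r i j l)))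

lemma faceAngle_eq_angle (r : V → ℝ) (i j k : V) (u v : EuclideanSpace ℝ (Fin 3))
    (hu : ‖u‖ = edgeLength r i j) (hv : ‖v‖ = edgeLength r i k)
    (huv : ‖u - v‖ = edgeLength r j k) :
    faceAngle r i j k = InnerProductGeometry.angle u v := by
  have h := norm_sub_sq_real u v
  rw [faceAngle, InnerProductGeometry.angle, ← hu, ← hv, ← huv, h]
  congr 1
  rw [show ‖u‖ ^ 2 + ‖v‖ ^ 2 - (‖u‖ ^ 2 - 2 * inner ℝ u v + ‖v‖ ^ 2) = 2 * inner ℝ u v by ring,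
    mul_assoc, mul_div_mul_left _ _ (two_ne_zero)]

/-- If four points of Euclidean space have the prescribed mutual distances, then `dihedralAngle`
is the angle between the components of `p_k - p_i` and `p_l - p_i` orthogonal to the edge
`p_j - p_i`. -/
theorem dihedralAngle_eq_angle (r : V → ℝ) (i j k l : V)
    (pi pj pk pl : EuclideanSpace ℝ (Fin 3)) (hij0 : pj ≠ pi)
    (hij : dist pj pi = edgeLength r i j) (hik : dist pk pi = edgeLength r i k)
    (hil : dist pl pi = edgeLength r i l) (hjk : dist pj pk = edgeLength r j k)
    (hjl : dist pj pl = edgeLength r j l) (hkl : dist pk pl = edgeLength r k l) :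
    dihedralAngle r i j k l = InnerProductGeometry.angle
      ((pk - pi) - (inner ℝ (pj - pi) (pk - pi) / ‖pj - pi‖ ^ 2) • (pj - pi))
      ((pl - pi) - (inner ℝ (pj - pi) (pl - pi) / ‖pj - pi‖ ^ 2) • (pj - pi)) := by
  rw [dist_eq_norm] at *
  have e1 := faceAngle_eq_angle r i j k (pj - pi) (pk - pi) hij hik (by simpa using hjk)
  have e2 := faceAngle_eq_angle r i j l (pj - pi) (pl - pi) hij hil (by simpa using hjl)
  have e3 := faceAngle_eq_angle r i k l (pk - pi) (pl - pi) hik hil (by simpa using hkl)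
  have hu0 : ‖pj - pi‖ ≠ 0 := norm_ne_zero_iff.2 (sub_ne_zero.2 hij0)
  rw [dihedralAngle, e1, e2, e3]
  generalize pj - pi = u at *
  generalize pk - pi = v at *
  generalize pl - pi = w at *
  have key : ∀ a b : EuclideanSpace ℝ (Fin 3),
      inner ℝ (a - (inner ℝ u a / ‖u‖ ^ 2) • u) (b - (inner ℝ u b / ‖u‖ ^ 2) • u)
        = inner ℝ a b - inner ℝ u a * inner ℝ u b / ‖u‖ ^ 2 := by
    intro a b
    simp only [inner_sub_left, inner_sub_right, real_inner_smul_left, real_inner_smul_right,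
      real_inner_self_eq_norm_sq, real_inner_comm u a]
    field_simp
    ring
  have hn : ∀ a : EuclideanSpace ℝ (Fin 3),
      ‖a - (inner ℝ u a / ‖u‖ ^ 2) • u‖
        = ‖a‖ * Real.sin (InnerProductGeometry.angle u a) := by
    intro a
    have hs := InnerProductGeometry.sin_angle_nonneg u a
    rw [← sq_eq_sq₀ (norm_nonneg _) (by positivity), ← real_inner_self_eq_norm_sq, key,
      real_inner_self_eq_norm_sq, mul_pow, Real.sin_sq,
      ← InnerProductGeometry.cos_angle_mul_norm_mul_norm u a]
    field_simp
  conv_rhs => rw [InnerProductGeometry.angle]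
  rw [key, hn, hn, ← InnerProductGeometry.cos_angle_mul_norm_mul_norm u v,
    ← InnerProductGeometry.cos_angle_mul_norm_mul_norm u w,
    ← InnerProductGeometry.cos_angle_mul_norm_mul_norm v w]
  congr 1
  by_cases hv : ‖v‖ = 0
  · have : v = 0 := norm_eq_zero.1 hv
    subst this
    simp
  by_cases hw : ‖w‖ = 0
  · have : w = 0 := norm_eq_zero.1 hw
    subst this
    simp
  field_simp

variable [DecidableEq V]

/-- The dihedral angle of the tetrahedron `t` along its edge `ij`. The average is over the two
orders `(k, l)` of the remaining two vertices, which give the same angle. -/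
def edgeDihedralAngle (r : V → ℝ) (t : Finset V) (i j : V) : ℝ :=
  (∑ p ∈ ((t.erase i).erase j).offDiag, dihedralAngle r i j p.1 p.2) / 2

/-- The solid angle of the tetrahedron `t` at its vertex `i`: the area of the spherical triangle
cut out on the unit sphere, that is, the sum of the three dihedral angles at `i` minus `π`. -/
def solidAngle (r : V → ℝ) (t : Finset V) (i : V) : ℝ :=
  (∑ j ∈ t.erase i, edgeDihedralAngle r t i j) - Real.pi

/-- The quantity `Q_ijkl` of the tetrahedron `t = {i, j, k, l}`. -/
def tetQ (r : V → ℝ) (t : Finset V) : ℝ :=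
  (∑ i ∈ t, 1 / r i) ^ 2 - 2 * ∑ i ∈ t, 1 / r i ^ 2

end Tetrahedron

/-- The Jacobian matrix `∂F_i/∂r_j` of a map of `ℝ^V` to itself. -/
def jacobian {V : Type*} [Fintype V] [DecidableEq V] (F : (V → ℝ) → (V → ℝ)) (r : V → ℝ) :
    Matrix V V ℝ :=
  LinearMap.toMatrix' (fderiv ℝ F r : (V → ℝ) →ₗ[ℝ] (V → ℝ))

namespace Triangulation

variable {V : Type*} [Fintype V] [DecidableEq V] {M : Type*} [TopologicalSpace M]
  (T : Triangulation V M)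

/-- `i ∼ j`: the vertices `i` and `j` are the end points of an edge. -/
def Adj (i j : V) : Prop := i ≠ j ∧ ∃ t ∈ T.tets, i ∈ t ∧ j ∈ t

/-- The space of sphere packing metrics: positive radii such that every tetrahedron is a
nondegenerate Euclidean tetrahedron. -/
def metrics : Set (V → ℝ) := {r | (∀ i, 0 < r i) ∧ ∀ t ∈ T.tets, 0 < tetQ r t}

/-- The combinatorial scalar curvature `K_i`. -/
def curvature (r : V → ℝ) (i : V) : ℝ :=
  4 * Real.pi - ∑ t ∈ T.tets with i ∈ t, solidAngle r t i

/-- The `α`-curvature `R_{α,i} = K_i / r_i^α`. -/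
def alphaCurvature (α : ℝ) (r : V → ℝ) (i : V) : ℝ := T.curvature r i / r i ^ α

/-- The metric `r` has constant `α`-curvature. -/
def IsConstAlphaCurvature (α : ℝ) (r : V → ℝ) : Prop :=
  ∃ c : ℝ, ∀ i, T.alphaCurvature α r i = c

/-- The Einstein-Hilbert-Regge functional `S = ∑ K_i r_i`. -/
def totalCurvature (r : V → ℝ) : ℝ := ∑ i, T.curvature r i * r i

/-- `s_α = S / ‖r‖_{α+1}^{α+1}`. -/
def sAlpha (α : ℝ) (r : V → ℝ) : ℝ := T.totalCurvature r / ∑ i, r i ^ (α + 1)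

/-- The vector field `Γ_i(r) = s_α r_i^α - K_i` of the `α`-flow. -/
def flowField (α : ℝ) (r : V → ℝ) (i : V) : ℝ :=
  T.sAlpha α r * r i ^ α - T.curvature r i

open scoped Classical in
/-- The `α`-Laplacian
`(Δ_α f)_i = r_i^{-α} ∑_{j ∼ i} (-(∂K_i/∂r_j) r_j) (f_j - f_i)`. -/
def alphaLaplacian (α : ℝ) (r : V → ℝ) : (V → ℝ) →ₗ[ℝ] (V → ℝ) where
  toFun f i := 1 / r i ^ α *
    ∑ j with T.Adj j i, (-(jacobian T.curvature r i j) * r j) * (f j - f i)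
  map_add' f g := by
    funext i
    simp only [Pi.add_apply, ← mul_add, ← Finset.sum_add_distrib]
    congr 1
    exact Finset.sum_congr rfl fun j _ => by ring
  map_smul' c f := by
    funext i
    simp only [Pi.smul_apply, smul_eq_mul, RingHom.id_apply, Finset.mul_sum]
    exact Finset.sum_congr rfl fun j _ => by ring

/-- `λ₁(-Δ_α)`: the first (smallest) positive eigenvalue of `-Δ_α`. -/
def firstPositiveEigenvalue (α : ℝ) (r : V → ℝ) : ℝ :=
  sInf {μ : ℝ | 0 < μ ∧ Module.End.HasEigenvalue (-(T.alphaLaplacian α r)) μ}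

end Triangulation

end

/-! At a metric of constant `α`-curvature, `-DΓ` is `DK` minus `α s_α` times the form `∑ r_i^(α-1)
x_i² - (∑ r_i^α x_i)² / ∑ r_i^(α+1)`, a weighted variance that vanishes along `r`. Since `DK` is
symmetric and kills `r` by scale invariance, `x` may be replaced by its component `y` with `∑ r_i^α
y_i = 0`. In the variables `f = y/r`, `DK` is `-Δ_α` up to weights, so its form at `y` is at least
`λ₁ ∑ r_i^(α-1) y_i²` (`firstPositiveEigenvalue_mul_le`). The hypothesis makes `λ₁ - α s_α`
positive; this gives semidefiniteness and the kernel, and rank-nullity gives the rank.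

The spectral gap needs `DK` to be positive semidefinite with kernel spanned by `r`. Differentiating
explicit cotangents of dihedral angles shows that each tetrahedron contributes to `DK` the Laplacian
form of a weighted complete graph on its vertices, evaluated at `x/r`. Some of its conductances may
be negative, but those at the vertex of largest curvature are positive. Eliminating that vertex
(star-triangle transformation) leaves a triangle with positive conductances, so the form is
semidefinite and vanishes only on constants (`tetWeight_form_nonneg_and_eq`). Connectedness of `M`
joins the constants of the tetrahedra (`eq_of_eq_on_tets`). -/

/-! ### Algebra of four curvatures: positivity of the Laplacian form -/

/-- The second elementary symmetric function of the curvatures `a`, `b`, `c` of three mutually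
tangent circles. -/
def triE (a b c : ℝ) : ℝ := a * b + b * c + c * a

/-- The quantity `Q` of four curvatures. -/
def quadQ (a b c d : ℝ) : ℝ := (a + b + c + d) ^ 2 - 2 * (a ^ 2 + b ^ 2 + c ^ 2 + d ^ 2)

/-- The numerator of the cotangent of the dihedral angle at the edge with curvatures `a`, `b`. -/
def edgeX (a b c d : ℝ) : ℝ := (a + b) * (c + d) - a ^ 2 - b ^ 2

/-- This is `1 + cot² = 1 / sin²` for the dihedral angle whose cotangent is `edgeX / ((a + b) √Q)`.
-/
lemma four_mul_triE_mul_triE (a b c d : ℝ) :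
    4 * (triE a b c * triE a b d) = edgeX a b c d ^ 2 + (a + b) ^ 2 * quadQ a b c d := by
  simp only [triE, edgeX, quadQ]; ring

/-- The conductance of the edge with curvatures `a`, `b`. -/
noncomputable def edgeWeight (a b c d : ℝ) : ℝ :=
  a * b * (quadQ a b c d - edgeX a b c d) / (√(quadQ a b c d) * triE a b c * triE a b d)

/-- The sum of squares certificate for the Laplacian form of a complete graph on four vertices:
eliminate the last vertex. -/
lemma laplacian_form_certificate (ab ac bc ad bd cd p q u v : ℝ) :
    (ad + bd + cd) * (ab * (p - q) ^ 2 + ac * (p - u) ^ 2 + bc * (q - u) ^ 2 +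
      ad * (p - v) ^ 2 + bd * (q - v) ^ 2 + cd * (u - v) ^ 2) =
    (ad * p + bd * q + cd * u - (ad + bd + cd) * v) ^ 2 +
      (ad * bd + ab * (ad + bd + cd)) * (p - q) ^ 2 +
      (ad * cd + ac * (ad + bd + cd)) * (p - u) ^ 2 +
      (bd * cd + bc * (ad + bd + cd)) * (q - u) ^ 2 := by
  ring

lemma triE_pos {a b c : ℝ} (ha : 0 < a) (hb : 0 < b) (hc : 0 < c) : 0 < triE a b c := by
  unfold triE; positivity

/-- The sign is that of `Q - X = 2ab + 2cd + a(c + d) + c(b - c) + d(b - d)`. Without a bound such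
as `c, d ≤ b` it can be negative. -/
lemma edgeWeight_pos {a b c d : ℝ} (ha : 0 < a) (hb : 0 < b) (hc : 0 < c) (hd : 0 < d)
    (hQ : 0 < quadQ a b c d) (hbd : c ≤ b) (hdb : d ≤ b) : 0 < edgeWeight a b c d := by
  have h1 := triE_pos ha hb hc
  have h2 := triE_pos ha hb hd
  have h3 : 0 < quadQ a b c d - edgeX a b c d := by
    simp only [quadQ, edgeX]
    nlinarith [mul_pos ha hb, mul_pos ha hc, mul_pos ha hd, mul_pos hc hd,
      mul_nonneg hc.le (sub_nonneg.2 hbd), mul_nonneg hd.le (sub_nonneg.2 hdb)]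
  unfold edgeWeight
  positivity

/-- The conductance, after elimination of the vertex with curvature `d`, of the opposite edge. -/
lemma eliminated_weight (a b c d : ℝ) (ha : 0 < a) (hb : 0 < b) (hc : 0 < c) (hd : 0 < d)
    (hQ : 0 < quadQ a b c d) :
    edgeWeight a d b c * edgeWeight b d a c +
      edgeWeight a b c d * (edgeWeight a d b c + edgeWeight b d a c + edgeWeight c d a b) =
    a * b * d * (4 * a * b * c + 3 * d * (a * b + a * c + b * c) + 3 * c ^ 2 * d +
      2 * c ^ 2 * (a + b) - 2 * c ^ 3) /
      (triE a b c * triE a b d * triE a c d * triE b c d) := by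
  have h1 := triE_pos ha hb hc
  have h2 := triE_pos ha hb hd
  have h3 := triE_pos ha hc hd
  have h4 := triE_pos hb hc hd
  have e1 : quadQ a d b c = quadQ a b c d := by unfold quadQ; ring
  have e2 : quadQ b d a c = quadQ a b c d := by unfold quadQ; ring
  have e3 : quadQ c d a b = quadQ a b c d := by unfold quadQ; ring
  have f1 : triE a d b = triE a b d := by unfold triE; ring
  have f2 : triE a d c = triE a c d := by unfold triE; ring
  have f3 : triE b d a = triE a b d := by unfold triE; ring
  have f4 : triE b d c = triE b c d := by unfold triE; ring
  have f5 : triE c d a = triE a c d := by unfold triE; ring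
  have f6 : triE c d b = triE b c d := by unfold triE; ring
  have hs : 0 < √(quadQ a b c d) := Real.sqrt_pos.2 hQ
  have hs2 : √(quadQ a b c d) ^ 2 = quadQ a b c d := Real.sq_sqrt hQ.le
  unfold edgeWeight
  rw [e1, e2, e3, f1, f2, f3, f4, f5, f6]
  generalize √(quadQ a b c d) = s at *
  -- Over the common denominator `Q` times the square of the product of the four `triE`, the
  -- numerator is divisible by `Q` and by that product, so the square roots disappear.
  have key : (a * d * (quadQ a b c d - edgeX a d b c)) * triE b c d *
        ((b * d * (quadQ a b c d - edgeX b d a c)) * triE a c d) * triE a b c ^ 2 +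
      (a * b * (quadQ a b c d - edgeX a b c d)) * triE a c d * triE b c d *
        ((a * d * (quadQ a b c d - edgeX a d b c)) * triE b c d * triE a b c +
        (b * d * (quadQ a b c d - edgeX b d a c)) * triE a c d * triE a b c +
        (c * d * (quadQ a b c d - edgeX c d a b)) * triE a b d * triE a b c) =
      quadQ a b c d * (a * b * d * (4 * a * b * c + 3 * d * (a * b + a * c + b * c) +
        3 * c ^ 2 * d + 2 * c ^ 2 * (a + b) - 2 * c ^ 3)) *
      (triE a b c * triE a b d * triE a c d * triE b c d) := by
    simp only [quadQ, edgeX, triE]; ring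
  rw [← hs2] at key ⊢
  generalize edgeX a b c d = x1 at *
  generalize edgeX a d b c = x2 at *
  generalize edgeX b d a c = x3 at *
  generalize edgeX c d a b = x4 at *
  generalize triE a b c = t1 at *
  generalize triE a b d = t2 at *
  generalize triE a c d = t3 at *
  generalize triE b c d = t4 at *
  generalize (4 * a * b * c + 3 * d * (a * b + a * c + b * c) +
        3 * c ^ 2 * d + 2 * c ^ 2 * (a + b) - 2 * c ^ 3) = y at *
  field_simp
  field_simp at key
  linear_combination key

/-- The only negative term of the numerator, `-2c³`, is absorbed by `3c²d` once `c ≤ d`. -/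
lemma eliminated_weight_pos {a b c d : ℝ} (ha : 0 < a) (hb : 0 < b) (hc : 0 < c) (hd : 0 < d)
    (hQ : 0 < quadQ a b c d) (hcd : c ≤ d) :
    0 < edgeWeight a d b c * edgeWeight b d a c +
      edgeWeight a b c d * (edgeWeight a d b c + edgeWeight b d a c + edgeWeight c d a b) := by
  rw [eliminated_weight a b c d ha hb hc hd hQ]
  have h1 := triE_pos ha hb hc
  have h2 := triE_pos ha hb hd
  have h3 := triE_pos ha hc hd
  have h4 := triE_pos hb hc hd
  have h5 : c ^ 3 ≤ c ^ 2 * d := by nlinarith [mul_nonneg (sq_nonneg c) (sub_nonneg.2 hcd)]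
  have h6 : 0 < 4 * a * b * c + 3 * d * (a * b + a * c + b * c) + 3 * c ^ 2 * d +
      2 * c ^ 2 * (a + b) - 2 * c ^ 3 := by
    have : 0 < 4 * a * b * c + 3 * d * (a * b + a * c + b * c) + c ^ 2 * d +
      2 * c ^ 2 * (a + b) := by positivity
    linarith
  positivity

/-- The Laplacian form of four mutually tangent spheres. -/
noncomputable def tetForm (a b c d p q u v : ℝ) : ℝ :=
  edgeWeight a b c d * (p - q) ^ 2 + edgeWeight a c b d * (p - u) ^ 2 +
    edgeWeight b c a d * (q - u) ^ 2 + edgeWeight a d b c * (p - v) ^ 2 +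
    edgeWeight b d a c * (q - v) ^ 2 + edgeWeight c d a b * (u - v) ^ 2

lemma edgeWeight_swap_right (a b c d : ℝ) : edgeWeight a b d c = edgeWeight a b c d := by
  simp only [edgeWeight, quadQ, edgeX, triE]
  ring_nf

/-- Maximality of `d` makes the three conductances at its vertex and the three eliminated ones
positive. The certificate then writes a positive multiple of the form as a sum of squares. -/
lemma tetForm_nonneg_and_eq {a b c d : ℝ} (ha : 0 < a) (hb : 0 < b) (hc : 0 < c)
    (hQ : 0 < quadQ a b c d) (had : a ≤ d) (hbd : b ≤ d) (hcd : c ≤ d) (p q u v : ℝ) :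
    0 ≤ tetForm a b c d p q u v ∧
      (tetForm a b c d p q u v = 0 → p = v ∧ q = v ∧ u = v) := by
  have hd : 0 < d := ha.trans_le had
  have e1 : quadQ a d b c = quadQ a b c d := by unfold quadQ; ring
  have e2 : quadQ b d a c = quadQ a b c d := by unfold quadQ; ring
  have e3 : quadQ c d a b = quadQ a b c d := by unfold quadQ; ring
  have e4 : quadQ a c b d = quadQ a b c d := by unfold quadQ; ring
  have e5 : quadQ b c a d = quadQ a b c d := by unfold quadQ; ring
  have w1 := edgeWeight_pos ha hd hb hc (e1 ▸ hQ) hbd hcd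
  have w2 := edgeWeight_pos hb hd ha hc (e2 ▸ hQ) had hcd
  have w3 := edgeWeight_pos hc hd ha hb (e3 ▸ hQ) had hbd
  have n1 := eliminated_weight_pos ha hb hc hd hQ hcd
  have n2 := eliminated_weight_pos ha hc hb hd (e4 ▸ hQ) hbd
  have n3 := eliminated_weight_pos hb hc ha hd (e5 ▸ hQ) had
  rw [edgeWeight_swap_right a d b c] at n2
  rw [edgeWeight_swap_right b d a c, edgeWeight_swap_right c d a b] at n3
  have key := laplacian_form_certificate (edgeWeight a b c d) (edgeWeight a c b d)
    (edgeWeight b c a d) (edgeWeight a d b c) (edgeWeight b d a c) (edgeWeight c d a b) p q u v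
  change _ * tetForm a b c d p q u v = _ at key
  generalize tetForm a b c d p q u v = F at *
  generalize edgeWeight a b c d = ab at *
  generalize edgeWeight a c b d = ac at *
  generalize edgeWeight b c a d = bc at *
  generalize edgeWeight a d b c = ad at *
  generalize edgeWeight b d a c = bd at *
  generalize edgeWeight c d a b = cd at *
  have hS : 0 < ad + bd + cd := by positivity
  replace n2 : 0 < ad * cd + ac * (ad + bd + cd) := by linarith
  replace n3 : 0 < bd * cd + bc * (ad + bd + cd) := by linarith
  have m0 := sq_nonneg (ad * p + bd * q + cd * u - (ad + bd + cd) * v)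
  have m1 := mul_nonneg n1.le (sq_nonneg (p - q))
  have m2 := mul_nonneg n2.le (sq_nonneg (p - u))
  have m3 := mul_nonneg n3.le (sq_nonneg (q - u))
  constructor
  · refine nonneg_of_mul_nonneg_right (b := F) ?_ hS
    rw [key]; positivity
  · intro hF
    rw [hF, mul_zero] at key
    have k1 : p - q = 0 := by
      have : (ad * bd + ab * (ad + bd + cd)) * (p - q) ^ 2 = 0 := by linarith
      simpa [n1.ne'] using this
    have k2 : p - u = 0 := by
      have : (ad * cd + ac * (ad + bd + cd)) * (p - u) ^ 2 = 0 := by linarith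
      simpa [n2.ne'] using this
    have k0 : ad * p + bd * q + cd * u - (ad + bd + cd) * v = 0 := by
      have : (ad * p + bd * q + cd * u - (ad + bd + cd) * v) ^ 2 = 0 := by linarith
      simpa using this
    obtain rfl : p = q := by linarith
    obtain rfl : p = u := by linarith
    have : (ad + bd + cd) * (p - v) = 0 := by linarith
    have : p - v = 0 := by simpa [hS.ne'] using this
    have : p = v := by linarith
    exact ⟨this, this, this⟩

/-! ### Face and dihedral angles in terms of curvatures -/

lemma cos_faceAngle {V : Type*} {r : V → ℝ} {i j k : V} (hi : 0 < r i) (hj : 0 < r j)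
    (hk : 0 < r k) :
    Real.cos (faceAngle r i j k) = 1 - 2 * (1 / r i) ^ 2 /
      ((1 / r i + 1 / r j) * (1 / r i + 1 / r k)) := by
  have e : (edgeLength r i j ^ 2 + edgeLength r i k ^ 2 - edgeLength r j k ^ 2) /
      (2 * edgeLength r i j * edgeLength r i k) = 1 - 2 * (1 / r i) ^ 2 /
      ((1 / r i + 1 / r j) * (1 / r i + 1 / r k)) := by
    unfold edgeLength
    field_simp
    ring
  rw [faceAngle, e, Real.cos_arccos]
  · have : (1 / r i) ^ 2 / ((1 / r i + 1 / r j) * (1 / r i + 1 / r k)) ≤ 1 := by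
      rw [div_le_one (by positivity), sq]
      gcongr <;> simp [hj.le, hk.le]
    rw [mul_div_assoc]
    linarith
  · have : 0 ≤ 2 * (1 / r i) ^ 2 / ((1 / r i + 1 / r j) * (1 / r i + 1 / r k)) := by positivity
    linarith

/-- The dihedral angle of four mutually tangent spheres, in terms of the curvatures. -/
lemma dihedralAngle_eq_arctan {V : Type*} {r : V → ℝ} {i j k l : V} (hi : 0 < r i) (hj : 0 < r j)
    (hk : 0 < r k) (hl : 0 < r l) (hQ : 0 < quadQ (1 / r i) (1 / r j) (1 / r k) (1 / r l)) :
    dihedralAngle r i j k l = Real.pi / 2 -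
      Real.arctan (edgeX (1 / r i) (1 / r j) (1 / r k) (1 / r l) /
        ((1 / r i + 1 / r j) * √(quadQ (1 / r i) (1 / r j) (1 / r k) (1 / r l)))) := by
  have hs : ∀ p q : V, Real.sin (faceAngle r i p q) =
      √(1 - Real.cos (faceAngle r i p q) ^ 2) := by
    intro p q
    rw [← Real.sin_sq, Real.sqrt_sq]
    exact Real.sin_arccos _ ▸ Real.sqrt_nonneg _
  rw [dihedralAngle, hs, hs, ← Real.sqrt_mul (by nlinarith [Real.cos_sq_le_one (faceAngle r i j k)]),
    cos_faceAngle hi hj hk, cos_faceAngle hi hj hl, cos_faceAngle hi hk hl]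
  have ha : 0 < 1 / r i := by positivity
  have hb : 0 < 1 / r j := by positivity
  have hc : 0 < 1 / r k := by positivity
  have hd : 0 < 1 / r l := by positivity
  generalize 1 / r i = a at *
  generalize 1 / r j = b at *
  generalize 1 / r k = c at *
  generalize 1 / r l = d at *
  have h1 := triE_pos ha hb hc
  have h2 := triE_pos ha hb hd
  have hsq : √(quadQ a b c d) ^ 2 = quadQ a b c d := Real.sq_sqrt hQ.le
  have hpos : 0 < √(quadQ a b c d) := Real.sqrt_pos.2 hQ
  -- `u` is the cotangent of the angle; the cosine is then `u / √(1 + u²) = sin (arctan u)`, whose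
  -- `arccos` is `π / 2 - arctan u`.
  set u := edgeX a b c d / ((a + b) * √(quadQ a b c d)) with hu
  have key : (1 - 2 * a ^ 2 / ((a + c) * (a + d)) -
      (1 - 2 * a ^ 2 / ((a + b) * (a + c))) * (1 - 2 * a ^ 2 / ((a + b) * (a + d)))) /
      √((1 - (1 - 2 * a ^ 2 / ((a + b) * (a + c))) ^ 2) *
        (1 - (1 - 2 * a ^ 2 / ((a + b) * (a + d))) ^ 2)) = u / √(1 + u ^ 2) := by
    have n1 : 1 - 2 * a ^ 2 / ((a + c) * (a + d)) -
        (1 - 2 * a ^ 2 / ((a + b) * (a + c))) * (1 - 2 * a ^ 2 / ((a + b) * (a + d))) =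
        2 * a ^ 2 / ((a + b) ^ 2 * (a + c) * (a + d)) * edgeX a b c d := by
      unfold edgeX
      field_simp
      ring
    have n2 : (1 - (1 - 2 * a ^ 2 / ((a + b) * (a + c))) ^ 2) *
        (1 - (1 - 2 * a ^ 2 / ((a + b) * (a + d))) ^ 2) =
        (2 * a ^ 2 / ((a + b) ^ 2 * (a + c) * (a + d))) ^ 2 *
          (4 * (triE a b c * triE a b d)) := by
      unfold triE
      field_simp
      ring
    have n3 : 1 + u ^ 2 = 4 * (triE a b c * triE a b d) / ((a + b) * √(quadQ a b c d)) ^ 2 := by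
      rw [four_mul_triE_mul_triE, hu, div_pow, mul_pow, hsq]
      field_simp
      ring
    rw [n1, n2, n3, Real.sqrt_mul (by positivity), Real.sqrt_sq (by positivity),
      Real.sqrt_div (by positivity), Real.sqrt_sq (by positivity), hu]
    have : 0 < √(4 * (triE a b c * triE a b d)) := Real.sqrt_pos.2 (by positivity)
    field_simp
  rw [key, ← Real.sin_arctan, Real.arccos, Real.arcsin_sin (Real.neg_pi_div_two_lt_arctan u).le
    (Real.arctan_lt_pi_div_two u).le]

lemma dihedralAngle_swap {V : Type*} (r : V → ℝ) (i j k l : V) :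
    dihedralAngle r i j l k = dihedralAngle r i j k l := by
  have : faceAngle r i l k = faceAngle r i k l := by
    simp only [faceAngle, edgeLength]
    ring_nf
  rw [dihedralAngle, dihedralAngle, this, mul_comm (Real.cos (faceAngle r i j l)),
    mul_comm (Real.sin (faceAngle r i j l))]

/-! ### Conductances of an unlabelled tetrahedron -/

/-- The conductance of the edge `ij` in the tetrahedron `t`. -/
noncomputable def tetWeight {V : Type*} (r : V → ℝ) (t : Finset V) (i j : V) : ℝ :=
  4 * (1 / r i) * (1 / r j) * (tetQ r t - ((1 / r i + 1 / r j) *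
    (∑ x ∈ t, 1 / r x - 1 / r i - 1 / r j) - (1 / r i) ^ 2 - (1 / r j) ^ 2)) /
    (√(tetQ r t) * (((1 / r i + 1 / r j) * (∑ x ∈ t, 1 / r x - 1 / r i - 1 / r j) -
      (1 / r i) ^ 2 - (1 / r j) ^ 2) ^ 2 + (1 / r i + 1 / r j) ^ 2 * tetQ r t))

lemma tetWeight_comm {V : Type*} (r : V → ℝ) (t : Finset V) (i j : V) :
    tetWeight r t i j = tetWeight r t j i := by
  unfold tetWeight
  ring_nf

section
variable {V : Type*} [DecidableEq V]

lemma edgeDihedralAngle_eq {r : V → ℝ} {t : Finset V} {i j k l : V} (hkl : k ≠ l)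
    (ht : (t.erase i).erase j = {k, l}) :
    edgeDihedralAngle r t i j = dihedralAngle r i j k l := by
  have : (({k, l} : Finset V)).offDiag = {(k, l), (l, k)} := by
    ext ⟨x, y⟩
    simp only [Finset.mem_offDiag, Finset.mem_insert, Finset.mem_singleton, Prod.mk.injEq]
    constructor
    · rintro ⟨rfl | rfl, rfl | rfl, h⟩ <;> simp_all
    · rintro (⟨rfl, rfl⟩ | ⟨rfl, rfl⟩) <;> simp [hkl, hkl.symm]
  rw [edgeDihedralAngle, ht, this, Finset.sum_pair (by simp [hkl]), dihedralAngle_swap r i j k l]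
  ring

lemma solidAngle_eq {r : V → ℝ} {i j k l : V} (hij : i ≠ j) (hik : i ≠ k) (hil : i ≠ l)
    (hjk : j ≠ k) (hjl : j ≠ l) (hkl : k ≠ l) :
    solidAngle r {i, j, k, l} i = dihedralAngle r i j k l + dihedralAngle r i k j l +
      dihedralAngle r i l j k - Real.pi := by
  have e0 : ({i, j, k, l} : Finset V).erase i = {j, k, l} := by
    ext x; simp only [Finset.mem_erase, Finset.mem_insert, Finset.mem_singleton]; grind
  have e1 : (({i, j, k, l} : Finset V).erase i).erase j = {k, l} := by
    ext x; simp only [Finset.mem_erase, Finset.mem_insert, Finset.mem_singleton]; grind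
  have e2 : (({i, j, k, l} : Finset V).erase i).erase k = {j, l} := by
    ext x; simp only [Finset.mem_erase, Finset.mem_insert, Finset.mem_singleton]; grind
  have e3 : (({i, j, k, l} : Finset V).erase i).erase l = {j, k} := by
    ext x; simp only [Finset.mem_erase, Finset.mem_insert, Finset.mem_singleton]; grind
  rw [solidAngle, e0, Finset.sum_insert (by simp [hjk, hjl]), Finset.sum_pair hkl,
    edgeDihedralAngle_eq hkl e1, edgeDihedralAngle_eq hjl e2, edgeDihedralAngle_eq hjk e3]
  ring

lemma sum_four {i j k l : V} (hij : i ≠ j) (hik : i ≠ k) (hil : i ≠ l)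
    (hjk : j ≠ k) (hjl : j ≠ l) (hkl : k ≠ l) (f : V → ℝ) :
    ∑ x ∈ ({i, j, k, l} : Finset V), f x = f i + f j + f k + f l := by
  rw [Finset.sum_insert (by simp [hij, hik, hil]), Finset.sum_insert (by simp [hjk, hjl]),
    Finset.sum_pair hkl]
  ring

lemma tetQ_eq_quadQ {r : V → ℝ} {i j k l : V} (hij : i ≠ j) (hik : i ≠ k) (hil : i ≠ l)
    (hjk : j ≠ k) (hjl : j ≠ l) (hkl : k ≠ l) :
    tetQ r {i, j, k, l} = quadQ (1 / r i) (1 / r j) (1 / r k) (1 / r l) := by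
  rw [tetQ, sum_four hij hik hil hjk hjl hkl, sum_four hij hik hil hjk hjl hkl, quadQ]
  ring

/-- A vertex of a four element set, together with the other three. -/
lemma exists_eq_of_card_four {t : Finset V} (ht : t.card = 4) {i : V} (hi : i ∈ t) :
    ∃ j k l, i ≠ j ∧ i ≠ k ∧ i ≠ l ∧ j ≠ k ∧ j ≠ l ∧ k ≠ l ∧ t = {i, j, k, l} := by
  have h3 : (t.erase i).card = 3 := by rw [Finset.card_erase_of_mem hi, ht]
  obtain ⟨j, k, l, hjk, hjl, hkl, h⟩ := Finset.card_eq_three.1 h3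
  have hmem : ∀ x ∈ ({j, k, l} : Finset V), i ≠ x := by
    intro x hx
    rw [← h] at hx
    exact (Finset.ne_of_mem_erase hx).symm
  refine ⟨j, k, l, hmem j (by simp), hmem k (by simp), hmem l (by simp), hjk, hjl, hkl, ?_⟩
  rw [← h, Finset.insert_erase hi]

/-- The opposite vertices enter `edgeWeight` only through `c + d`, `Q` and `triE a b c * triE a b
d`, and `four_mul_triE_mul_triE` expresses the last through the others; so `tetWeight` needs no
labelling of them. -/
lemma tetWeight_eq_edgeWeight (r : V → ℝ) {t : Finset V} {i j k l : V} (hij : i ≠ j)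
    (hik : i ≠ k) (hil : i ≠ l) (hjk : j ≠ k) (hjl : j ≠ l) (hkl : k ≠ l)
    (ht : t = {i, j, k, l}) :
    tetWeight r t i j = edgeWeight (1 / r i) (1 / r j) (1 / r k) (1 / r l) := by
  subst ht
  rw [tetWeight, tetQ_eq_quadQ hij hik hil hjk hjl hkl, sum_four hij hik hil hjk hjl hkl]
  generalize 1 / r i = a at *
  generalize 1 / r j = b at *
  generalize 1 / r k = c at *
  generalize 1 / r l = d at *
  have e : (a + b) * (a + b + c + d - a - b) - a ^ 2 - b ^ 2 = edgeX a b c d := by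
    unfold edgeX; ring
  rw [e, ← four_mul_triE_mul_triE, edgeWeight]
  rw [show √(quadQ a b c d) * (4 * (triE a b c * triE a b d)) =
    4 * (√(quadQ a b c d) * triE a b c * triE a b d) by ring,
    show 4 * a * b * (quadQ a b c d - edgeX a b c d) =
    4 * (a * b * (quadQ a b c d - edgeX a b c d)) by ring, mul_div_mul_left _ _ four_ne_zero]

/-- The Laplacian form of a tetrahedron is positive semidefinite, with kernel the constants. -/
lemma tetWeight_form_nonneg_and_eq {r : V → ℝ} {t : Finset V} (ht : t.card = 4)
    (hr : ∀ i ∈ t, 0 < r i) (hQ : 0 < tetQ r t) (f : V → ℝ) :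
    0 ≤ ∑ i ∈ t, ∑ j ∈ t, tetWeight r t i j * (f i - f j) ^ 2 ∧
      (∑ i ∈ t, ∑ j ∈ t, tetWeight r t i j * (f i - f j) ^ 2 = 0 →
        ∀ i ∈ t, ∀ j ∈ t, f i = f j) := by
  -- The vertex to eliminate is the one of largest curvature.
  obtain ⟨l, hl, hmax⟩ := t.exists_max_image (fun i => 1 / r i) (Finset.card_pos.1 (by omega))
  obtain ⟨i, j, k, hli, hlj, hlk, hij, hik, hjk, hset⟩ := exists_eq_of_card_four ht hl
  obtain rfl : t = {i, j, k, l} := by rw [hset]; grind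
  have hinv : ∀ x ∈ ({i, j, k, l} : Finset V), 0 < 1 / r x := fun x hx => by
    have := hr x hx; positivity
  have hF := tetForm_nonneg_and_eq (hinv i (by simp)) (hinv j (by simp)) (hinv k (by simp))
    (tetQ_eq_quadQ (r := r) hij hik hli.symm hjk hlj.symm hlk.symm ▸ hQ) (hmax i (by simp))
    (hmax j (by simp)) (hmax k (by simp)) (f i) (f j) (f k) (f l)
  -- Ordered pairs count each edge twice; diagonal terms vanish whatever value `tetWeight` has
  -- there.
  have e : ∑ x ∈ ({i, j, k, l} : Finset V), ∑ y ∈ ({i, j, k, l} : Finset V),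
      tetWeight r {i, j, k, l} x y * (f x - f y) ^ 2 = 2 * tetForm (1 / r i) (1 / r j) (1 / r k)
        (1 / r l) (f i) (f j) (f k) (f l) := by
    simp only [sum_four hij hik hli.symm hjk hlj.symm hlk.symm]
    rw [tetWeight_comm r _ j i, tetWeight_comm r _ k i, tetWeight_comm r _ l i,
      tetWeight_comm r _ k j, tetWeight_comm r _ l j, tetWeight_comm r _ l k,
      tetWeight_eq_edgeWeight r hij hik hli.symm hjk hlj.symm hlk.symm rfl,
      tetWeight_eq_edgeWeight r hik hij hli.symm hjk.symm hlk.symm hlj.symm (by grind),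
      tetWeight_eq_edgeWeight r hli.symm hij hik hlj hlk hjk (by grind),
      tetWeight_eq_edgeWeight r hjk hij.symm hlj.symm hik.symm hlk.symm hli.symm (by grind),
      tetWeight_eq_edgeWeight r hlj.symm hij.symm hjk hli hlk hik (by grind),
      tetWeight_eq_edgeWeight r hlk.symm hik.symm hjk.symm hli hlj hij (by grind), tetForm]
    ring
  rw [e]
  refine ⟨by linarith [hF.1], fun h => ?_⟩
  obtain ⟨h1, h2, h3⟩ := hF.2 (by linarith)
  have hc : ∀ x ∈ ({i, j, k, l} : Finset V), f x = f l := by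
    intro x hx
    simp only [Finset.mem_insert, Finset.mem_singleton] at hx
    rcases hx with rfl | rfl | rfl | rfl <;> first | assumption | rfl
  intro x hx y hy
  rw [hc x hx, hc y hy]

end

/-! ### Variation of the solid angles -/

/-- The derivative of the complementary dihedral angle at the edge `ab`, when the curvatures
have logarithmic derivatives `-p`, `-q`, `-u`, `-v`. -/
noncomputable def edgeDeriv (a b c d p q u v : ℝ) : ℝ :=
  (2 * (((-a * p - b * q) * (c + d) + (a + b) * (-c * u - d * v) + 2 * a ^ 2 * p
      + 2 * b ^ 2 * q) * (a + b) - edgeX a b c d * (-a * p - b * q)) * quadQ a b c d -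
    edgeX a b c d * (a + b) * (2 * (a + b + c + d) * (-a * p - b * q - c * u - d * v) +
      4 * (a ^ 2 * p + b ^ 2 * q + c ^ 2 * u + d ^ 2 * v))) /
    (8 * √(quadQ a b c d) * triE a b c * triE a b d)

lemma hasDerivAt_arctan_edge {a b c d : ℝ → ℝ} {x p q u v : ℝ}
    (ha : HasDerivAt a (-a x * p) x) (hb : HasDerivAt b (-b x * q) x)
    (hc : HasDerivAt c (-c x * u) x) (hd : HasDerivAt d (-d x * v) x)
    (ha0 : 0 < a x) (hb0 : 0 < b x) (hc0 : 0 < c x) (hd0 : 0 < d x)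
    (hQ : 0 < quadQ (a x) (b x) (c x) (d x)) :
    HasDerivAt (fun s => Real.arctan (edgeX (a s) (b s) (c s) (d s) /
        ((a s + b s) * √(quadQ (a s) (b s) (c s) (d s)))))
      (edgeDeriv (a x) (b x) (c x) (d x) p q u v) x := by
  have hS := ha.add hb
  have hX : HasDerivAt (fun s => edgeX (a s) (b s) (c s) (d s)) _ x :=
    ((hS.mul (hc.add hd)).sub (ha.pow 2)).sub (hb.pow 2)
  have hQ' : HasDerivAt (fun s => quadQ (a s) (b s) (c s) (d s)) _ x :=
    (((hS.add hc).add hd).pow 2).sub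
      (((((ha.pow 2).add (hb.pow 2)).add (hc.pow 2)).add (hd.pow 2)).const_mul 2)
  have hq := hQ'.sqrt hQ.ne'
  have hs : 0 < √(quadQ (a x) (b x) (c x) (d x)) := Real.sqrt_pos.2 hQ
  have h0 : (a x + b x) * √(quadQ (a x) (b x) (c x) (d x)) ≠ 0 := by positivity
  have main := (hX.div (hS.mul hq) h0).arctan
  refine main.congr_deriv ?_
  have hsq : √(quadQ (a x) (b x) (c x) (d x)) ^ 2 = quadQ (a x) (b x) (c x) (d x) :=
    Real.sq_sqrt hQ.le
  have h1 := triE_pos ha0 hb0 hc0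
  have h2 := triE_pos ha0 hb0 hd0
  simp only [Pi.add_apply, Pi.mul_apply, Pi.div_apply]
  have e : 1 + (edgeX (a x) (b x) (c x) (d x) /
      ((a x + b x) * √(quadQ (a x) (b x) (c x) (d x)))) ^ 2 =
      4 * (triE (a x) (b x) (c x) * triE (a x) (b x) (d x)) /
        ((a x + b x) * √(quadQ (a x) (b x) (c x) (d x))) ^ 2 := by
    rw [four_mul_triE_mul_triE, div_pow, mul_pow, hsq]
    field_simp
    ring
  rw [e, edgeDeriv]
  clear e main hq hQ' hX hS
  rw [← hsq]
  simp only [Real.sqrt_sq hs.le]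
  generalize √(quadQ (a x) (b x) (c x) (d x)) = s at *
  generalize edgeX (a x) (b x) (c x) (d x) = X at *
  generalize triE (a x) (b x) (c x) = e1 at *
  generalize triE (a x) (b x) (d x) = e2 at *
  generalize a x = a at *
  generalize b x = b at *
  generalize c x = c at *
  generalize d x = d at *
  push_cast
  simp only [pow_one]
  field_simp
  ring

/-- The variation of the solid angle of four mutually tangent spheres. -/
lemma edgeDeriv_sum {a b c d : ℝ} (p q u v : ℝ)
    (ha : 0 < a) (hb : 0 < b) (hc : 0 < c) (hd : 0 < d) (hQ : 0 < quadQ a b c d) :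
    -(edgeDeriv a b c d p q u v + edgeDeriv a c b d p u q v + edgeDeriv a d b c p v q u) =
      a * (edgeWeight a b c d * (q - p) + edgeWeight a c b d * (u - p) +
        edgeWeight a d b c * (v - p)) := by
  have h1 := triE_pos ha hb hc
  have h2 := triE_pos ha hb hd
  have h3 := triE_pos ha hc hd
  have e1 : quadQ a d b c = quadQ a b c d := by unfold quadQ; ring
  have e4 : quadQ a c b d = quadQ a b c d := by unfold quadQ; ring
  have f1 : triE a d b = triE a b d := by unfold triE; ring
  have f2 : triE a d c = triE a c d := by unfold triE; ring
  have f3 : triE a c b = triE a b c := by unfold triE; ring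
  have hs : 0 < √(quadQ a b c d) := Real.sqrt_pos.2 hQ
  unfold edgeDeriv edgeWeight
  rw [e1, e4, f1, f2, f3]
  generalize √(quadQ a b c d) = s at *
  field_simp
  simp only [quadQ, edgeX, triE]
  ring

lemma eventually_quadQ_pos {V : Type*} {r : V → ℝ} {i j k l : V} (hi : 0 < r i) (hj : 0 < r j)
    (hk : 0 < r k) (hl : 0 < r l) (hQ : 0 < quadQ (1 / r i) (1 / r j) (1 / r k) (1 / r l)) :
    ∀ᶠ r' in nhds r, 0 < quadQ (1 / r' i) (1 / r' j) (1 / r' k) (1 / r' l) := by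
  have h : ∀ i, 0 < r i → ContinuousAt (fun r' : V → ℝ => 1 / r' i) r := fun i hi =>
    continuousAt_const.div (continuous_apply i).continuousAt hi.ne'
  have := h i hi
  have := h j hj
  have := h k hk
  have := h l hl
  have hc : ContinuousAt (fun r' : V → ℝ =>
      quadQ (1 / r' i) (1 / r' j) (1 / r' k) (1 / r' l)) r := by
    unfold quadQ; fun_prop
  exact hc.eventually_const_lt hQ

/-- The nondegeneracy conditions are open, so the arctangent formula can be differentiated in place
of the solid angle. The constant is `3 · π / 2 - π`. -/
lemma eventually_solidAngle_eq {V : Type*} [DecidableEq V] {r : V → ℝ} {i j k l : V} (hij : i ≠ j) (hik : i ≠ k)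
    (hil : i ≠ l) (hjk : j ≠ k) (hjl : j ≠ l) (hkl : k ≠ l) (hi : 0 < r i) (hj : 0 < r j)
    (hk : 0 < r k) (hl : 0 < r l) (hQ : 0 < quadQ (1 / r i) (1 / r j) (1 / r k) (1 / r l)) :
    (fun r' => solidAngle r' {i, j, k, l} i) =ᶠ[nhds r] fun r' => Real.pi / 2 -
      (Real.arctan (edgeX (1 / r' i) (1 / r' j) (1 / r' k) (1 / r' l) /
        ((1 / r' i + 1 / r' j) * √(quadQ (1 / r' i) (1 / r' j) (1 / r' k) (1 / r' l)))) +
      Real.arctan (edgeX (1 / r' i) (1 / r' k) (1 / r' j) (1 / r' l) /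
        ((1 / r' i + 1 / r' k) * √(quadQ (1 / r' i) (1 / r' k) (1 / r' j) (1 / r' l)))) +
      Real.arctan (edgeX (1 / r' i) (1 / r' l) (1 / r' j) (1 / r' k) /
        ((1 / r' i + 1 / r' l) * √(quadQ (1 / r' i) (1 / r' l) (1 / r' j) (1 / r' k))))) := by
  have h : ∀ i, 0 < r i → ∀ᶠ r' : V → ℝ in nhds r, 0 < r' i := fun i hi =>
    (continuous_apply i).continuousAt.eventually_const_lt hi
  filter_upwards [h i hi, h j hj, h k hk, h l hl, eventually_quadQ_pos hi hj hk hl hQ]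
    with r' hi hj hk hl hQ
  have e1 : quadQ (1 / r' i) (1 / r' k) (1 / r' j) (1 / r' l) =
    quadQ (1 / r' i) (1 / r' j) (1 / r' k) (1 / r' l) := by unfold quadQ; ring
  have e2 : quadQ (1 / r' i) (1 / r' l) (1 / r' j) (1 / r' k) =
    quadQ (1 / r' i) (1 / r' j) (1 / r' k) (1 / r' l) := by unfold quadQ; ring
  rw [solidAngle_eq hij hik hil hjk hjl hkl, dihedralAngle_eq_arctan hi hj hk hl hQ,
    dihedralAngle_eq_arctan hi hk hj hl (e1 ▸ hQ), dihedralAngle_eq_arctan hi hl hj hk (e2 ▸ hQ)]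
  ring

lemma differentiableAt_arctan_edge {V : Type*} [Fintype V] {r : V → ℝ} {i j k l : V} (hi : 0 < r i) (hj : 0 < r j)
    (hk : 0 < r k) (hl : 0 < r l) (hQ : 0 < quadQ (1 / r i) (1 / r j) (1 / r k) (1 / r l)) :
    DifferentiableAt ℝ (fun r' : V → ℝ =>
      Real.arctan (edgeX (1 / r' i) (1 / r' j) (1 / r' k) (1 / r' l) /
        ((1 / r' i + 1 / r' j) * √(quadQ (1 / r' i) (1 / r' j) (1 / r' k) (1 / r' l))))) r := by
  have h : ∀ i, 0 < r i → DifferentiableAt ℝ (fun r' : V → ℝ => 1 / r' i) r := by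
    intro i hi
    simp only [one_div]
    exact DifferentiableAt.fun_inv (by fun_prop) hi.ne'
  have := h i hi
  have := h j hj
  have := h k hk
  have := h l hl
  have hd : DifferentiableAt ℝ (fun r' : V → ℝ =>
      quadQ (1 / r' i) (1 / r' j) (1 / r' k) (1 / r' l)) r := by
    unfold quadQ; fun_prop
  have hX : DifferentiableAt ℝ (fun r' : V → ℝ =>
      edgeX (1 / r' i) (1 / r' j) (1 / r' k) (1 / r' l)) r := by
    unfold edgeX; fun_prop
  have hs := Real.sqrt_pos.2 hQ
  simp only [div_eq_mul_inv (edgeX _ _ _ _)]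
  exact (hX.mul ((((h i hi).add (h j hj)).mul (hd.sqrt hQ.ne')).fun_inv (by
    simp only [Pi.mul_apply, Pi.add_apply]; positivity))).arctan

/-- Differentiability being known, the derivative is computed along the line `r + s x`, where `1 / r
i` has logarithmic derivative `-x i / r i`. -/
lemma fderiv_arctan_edge {V : Type*} [Fintype V] {r : V → ℝ} (x : V → ℝ) {i j k l : V} (hi : 0 < r i)
    (hj : 0 < r j) (hk : 0 < r k) (hl : 0 < r l)
    (hQ : 0 < quadQ (1 / r i) (1 / r j) (1 / r k) (1 / r l)) :
    fderiv ℝ (fun r' : V → ℝ =>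
      Real.arctan (edgeX (1 / r' i) (1 / r' j) (1 / r' k) (1 / r' l) /
        ((1 / r' i + 1 / r' j) * √(quadQ (1 / r' i) (1 / r' j) (1 / r' k) (1 / r' l))))) r x =
      edgeDeriv (1 / r i) (1 / r j) (1 / r k) (1 / r l) (x i / r i) (x j / r j) (x k / r k)
        (x l / r l) := by
  have h : ∀ i, 0 < r i → HasDerivAt (fun s : ℝ => 1 / (r + s • x) i)
      (-(1 / (r + (0 : ℝ) • x) i) * (x i / r i)) 0 := by
    intro i hi
    have h1 : HasDerivAt (fun s : ℝ => (r + s • x) i) (x i) 0 := by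
      simpa using ((hasDerivAt_id (0 : ℝ)).mul_const (x i)).const_add (r i)
    have := h1.inv (by simpa using hi.ne')
    simp only [one_div]
    refine this.congr_deriv ?_
    simp
    field_simp
  have e : ∀ i, 1 / (r + (0 : ℝ) • x) i = 1 / r i := fun i => by simp
  have := hasDerivAt_arctan_edge (h i hi) (h j hj) (h k hk) (h l hl)
    (by rw [e]; positivity) (by rw [e]; positivity) (by rw [e]; positivity)
    (by rw [e]; positivity) (by simp only [e]; exact hQ)
  simp only [e] at this
  rw [← (differentiableAt_arctan_edge hi hj hk hl hQ).lineDeriv_eq_fderiv]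
  exact this.deriv

/-- The solid angles depend smoothly on a sphere packing metric, and their variation is given by
the conductances `tetWeight`. -/
lemma solidAngle_hasFDerivAt {V : Type*} [Fintype V] [DecidableEq V] {r : V → ℝ} {t : Finset V} (ht : t.card = 4)
    (hr : ∀ i ∈ t, 0 < r i) (hQ : 0 < tetQ r t) {i : V} (hi : i ∈ t) :
    DifferentiableAt ℝ (fun r' => solidAngle r' t i) r ∧
    ∀ x, fderiv ℝ (fun r' => solidAngle r' t i) r x =
      1 / r i * ∑ j ∈ t, tetWeight r t i j * (x j / r j - x i / r i) := by
  obtain ⟨j, k, l, hij, hik, hil, hjk, hjl, hkl, rfl⟩ := exists_eq_of_card_four ht hi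
  rw [tetQ_eq_quadQ hij hik hil hjk hjl hkl] at hQ
  have pi := hr i (by simp)
  have pj := hr j (by simp)
  have pk := hr k (by simp)
  have pl := hr l (by simp)
  have e1 : quadQ (1 / r i) (1 / r k) (1 / r j) (1 / r l) =
    quadQ (1 / r i) (1 / r j) (1 / r k) (1 / r l) := by unfold quadQ; ring
  have e2 : quadQ (1 / r i) (1 / r l) (1 / r j) (1 / r k) =
    quadQ (1 / r i) (1 / r j) (1 / r k) (1 / r l) := by unfold quadQ; ring
  have hev := eventually_solidAngle_eq hij hik hil hjk hjl hkl pi pj pk pl hQ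
  have main := HasFDerivAt.congr_of_eventuallyEq
    ((((differentiableAt_arctan_edge pi pj pk pl hQ).hasFDerivAt.add
      (differentiableAt_arctan_edge pi pk pj pl (e1 ▸ hQ)).hasFDerivAt).add
      (differentiableAt_arctan_edge pi pl pj pk (e2 ▸ hQ)).hasFDerivAt).const_sub (Real.pi / 2))
    hev
  refine ⟨main.differentiableAt, fun x => ?_⟩
  rw [main.fderiv, neg_apply, add_apply,
    add_apply, fderiv_arctan_edge x pi pj pk pl hQ,
    fderiv_arctan_edge x pi pk pj pl (e1 ▸ hQ), fderiv_arctan_edge x pi pl pj pk (e2 ▸ hQ)]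
  rw [edgeDeriv_sum _ _ _ _ (by positivity) (by positivity) (by positivity) (by positivity) hQ,
    sum_four hij hik hil hjk hjl hkl, tetWeight_eq_edgeWeight r hij hik hil hjk hjl hkl rfl,
    tetWeight_eq_edgeWeight r hik hij hil hjk.symm hkl hjl (by grind),
    tetWeight_eq_edgeWeight r hil hij hik hjl.symm hkl.symm hjk (by grind)]
  ring

/-! ### Spectral gap of a semidefinite matrix -/

/-- The spectral gap: a positive semidefinite quadratic form is bounded below, on the orthogonal
complement of its kernel, by any lower bound of its positive eigenvalues. -/
lemma Matrix.PosSemidef.mul_dotProduct_le_of_le_eigenvalue {n : Type*} [Fintype n] [DecidableEq n]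
    {H : Matrix n n ℝ} (hH : H.PosSemidef) {lam : ℝ}
    (hlam : ∀ μ > 0, ∀ u ≠ 0, H *ᵥ u = μ • u → lam ≤ μ) {g : n → ℝ}
    (hg : ∀ u, H *ᵥ u = 0 → u ⬝ᵥ g = 0) : lam * (g ⬝ᵥ g) ≤ g ⬝ᵥ H *ᵥ g := by
  have hin : ∀ x y : n → ℝ, inner ℝ (WithLp.toLp 2 x) (WithLp.toLp 2 y) = x ⬝ᵥ y := by
    intro x y
    rw [EuclideanSpace.inner_toLp_toLp, dotProduct_comm]
    simp
  set b := hH.1.eigenvectorBasis with hb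
  have hexp : ∀ x y : n → ℝ, ∑ k, (x ⬝ᵥ (b k).ofLp) * ((b k).ofLp ⬝ᵥ y) = x ⬝ᵥ y := by
    intro x y
    rw [← hin, ← b.sum_inner_mul_inner]
    refine Finset.sum_congr rfl fun k _ => ?_
    rw [← hin, ← hin]
  have heig : ∀ k, H *ᵥ (b k).ofLp = hH.1.eigenvalues k • (b k).ofLp :=
    hH.1.mulVec_eigenvectorBasis
  have hne : ∀ k, (b k).ofLp ≠ 0 := by
    intro k h
    have := b.orthonormal.ne_zero k
    exact this (by ext i; exact congrFun h i)
  rw [← hexp g g, ← hexp g (H *ᵥ g), Finset.mul_sum]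
  refine Finset.sum_le_sum fun k _ => ?_
  have h1 : (b k).ofLp ⬝ᵥ H *ᵥ g = hH.1.eigenvalues k * ((b k).ofLp ⬝ᵥ g) := by
    have hT : Hᵀ = H := by simpa [Matrix.IsHermitian, Matrix.conjTranspose_eq_transpose_of_trivial]
      using hH.1
    rw [Matrix.dotProduct_mulVec, ← Matrix.mulVec_transpose, hT, heig, smul_dotProduct,
      smul_eq_mul]
  rw [h1, dotProduct_comm g]
  -- The inequality holds for each eigenvector: null ones are orthogonal to `g`, the others have
  -- eigenvalue at least `lam`.
  rcases (hH.eigenvalues_nonneg k).eq_or_lt with h0 | h0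
  · have := hg _ (by rw [heig, ← h0, zero_smul])
    rw [this]; simp
  · have := hlam _ h0 _ (hne k) (heig k)
    nlinarith [mul_le_mul_of_nonneg_right this (mul_self_nonneg ((b k).ofLp ⬝ᵥ g))]

section
variable {V : Type*} [Fintype V] [DecidableEq V]

lemma jacobian_mulVec (F : (V → ℝ) → V → ℝ) (r x : V → ℝ) :
    jacobian F r *ᵥ x = fderiv ℝ F r x := by
  rw [jacobian, LinearMap.toMatrix'_mulVec]
  rfl

lemma jacobian_apply (F : (V → ℝ) → V → ℝ) (r : V → ℝ) (i j : V) :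
    jacobian F r i j = fderiv ℝ F r (Pi.single j 1) i := by
  rw [← jacobian_mulVec, Matrix.mulVec_single_one, Matrix.col_apply]

end

/-! ### Connectedness, and the variation of the curvature -/

namespace Triangulation

variable {V : Type*} [Fintype V] [DecidableEq V] {M : Type*} [TopologicalSpace M]
  (T : Triangulation V M)

lemma vertex_mem_realization (v : V) :
    (Pi.single v 1 : V → ℝ) ∈ geometricRealization T.tets := by
  obtain ⟨t, ht, hv⟩ := T.exists_tet v
  refine ⟨fun w => ?_, by simp, t, ht, fun w hw => ?_⟩
  · by_cases h : w = v
    · subst h; simp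
    · simp [h]
  · have : w ≠ v := fun h => hw (h ▸ hv)
    simp [this]

lemma isConnected_realization [ConnectedSpace M] : IsConnected (geometricRealization T.tets) := by
  have : ConnectedSpace (geometricRealization T.tets) :=
    T.homeo.symm.surjective.connectedSpace T.homeo.symm.continuous
  exact isConnected_iff_connectedSpace.2 this

lemma nonempty_vertices (T : Triangulation V M) [ConnectedSpace M] : Nonempty V := by
  obtain ⟨x, -, hx, -⟩ := T.isConnected_realization.nonempty
  by_contra h
  rw [not_nonempty_iff] at h
  simp at hx

/-- A function that is constant on every tetrahedron is constant. -/
lemma eq_of_eq_on_tets [ConnectedSpace M] {f : V → ℝ}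
    (hf : ∀ t ∈ T.tets, ∀ i ∈ t, ∀ j ∈ t, f i = f j) (v w : V) : f v = f w := by
  -- The affine extension of `f` is continuous with values in the finite set `Set.range f`, hence
  -- constant on the connected realization, which contains the vertices.
  have hc : ContinuousOn (fun x : V → ℝ => ∑ i, x i * f i) (geometricRealization T.tets) := by
    fun_prop
  have hsub : (fun x : V → ℝ => ∑ i, x i * f i) '' geometricRealization T.tets ⊆ Set.range f := by
    rintro _ ⟨x, ⟨-, hx, t, ht, hxt⟩, rfl⟩
    obtain ⟨v, hv⟩ : t.Nonempty := Finset.card_pos.1 (by rw [T.card_tet t ht]; norm_num)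
    refine ⟨v, ?_⟩
    have : ∀ i, x i * f i = x i * f v := fun i => by
      by_cases hi : i ∈ t
      · rw [hf t ht i hi v hv]
      · simp [hxt i hi]
    simp only [this, ← Finset.sum_mul, hx, one_mul]
  have hss := (Set.finite_range f).countable.isTotallyDisconnected _ hsub
    (T.isConnected_realization.isPreconnected.image _ hc)
  have := hss ⟨_, T.vertex_mem_realization v, rfl⟩ ⟨_, T.vertex_mem_realization w, rfl⟩
  simpa [Pi.single_apply] using this

variable {T} {r : V → ℝ}

lemma hasFDerivAt_curvature (hr : r ∈ T.metrics) :
    HasFDerivAt T.curvature (ContinuousLinearMap.pi fun i =>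
      -∑ t ∈ T.tets with i ∈ t, fderiv ℝ (fun r' => solidAngle r' t i) r) r := by
  refine hasFDerivAt_pi.2 fun i => HasFDerivAt.const_sub
    (f := fun r' => ∑ t ∈ T.tets with i ∈ t, solidAngle r' t i)
    (HasFDerivAt.fun_sum fun t ht => ?_) (4 * Real.pi)
  rw [Finset.mem_filter] at ht
  exact (solidAngle_hasFDerivAt (T.card_tet t ht.1) (fun i _ => hr.1 i) (hr.2 t ht.1)
    ht.2).1.hasFDerivAt

lemma fderiv_curvature (hr : r ∈ T.metrics) (x : V → ℝ) (i : V) :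
    fderiv ℝ T.curvature r x i = 1 / r i * ∑ t ∈ T.tets with i ∈ t,
      ∑ j ∈ t, tetWeight r t i j * (x i / r i - x j / r j) := by
  rw [(hasFDerivAt_curvature hr).fderiv]
  simp only [ContinuousLinearMap.coe_pi', neg_apply, sum_apply]
  rw [Finset.mul_sum, ← Finset.sum_neg_distrib]
  refine Finset.sum_congr rfl fun t ht => ?_
  rw [Finset.mem_filter] at ht
  rw [(solidAngle_hasFDerivAt (T.card_tet t ht.1) (fun i _ => hr.1 i) (hr.2 t ht.1) ht.2).2,
    ← mul_neg, ← Finset.sum_neg_distrib]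
  congr 1
  exact Finset.sum_congr rfl fun j _ => by ring

/-- The variation of the curvature is a symmetric bilinear form. -/
lemma dotProduct_fderiv_curvature (hr : r ∈ T.metrics) (x y : V → ℝ) :
    y ⬝ᵥ fderiv ℝ T.curvature r x = 1 / 2 * ∑ t ∈ T.tets, ∑ i ∈ t, ∑ j ∈ t,
      tetWeight r t i j * ((y i / r i - y j / r j) * (x i / r i - x j / r j)) := by
  have h1 : y ⬝ᵥ fderiv ℝ T.curvature r x = ∑ t ∈ T.tets, ∑ i ∈ t, ∑ j ∈ t,
      tetWeight r t i j * (y i / r i * (x i / r i - x j / r j)) := by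
    simp only [dotProduct, fderiv_curvature hr, Finset.sum_filter, Finset.mul_sum]
    rw [Finset.sum_comm]
    refine Finset.sum_congr rfl fun t _ => ?_
    rw [← Finset.sum_subset (Finset.subset_univ t)]
    · refine Finset.sum_congr rfl fun i hi => ?_
      rw [if_pos hi, Finset.mul_sum, Finset.mul_sum]
      exact Finset.sum_congr rfl fun j _ => by ring
    · intro i _ hi
      simp [hi]
  rw [h1, Finset.mul_sum]
  refine Finset.sum_congr rfl fun t _ => ?_
  -- Summation by parts: exchange `i` and `j`, using the symmetry of the conductances, and average.
  have h2 : ∑ i ∈ t, ∑ j ∈ t, tetWeight r t i j * (y i / r i * (x i / r i - x j / r j)) =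
      ∑ i ∈ t, ∑ j ∈ t, tetWeight r t i j * (-(y j / r j) * (x i / r i - x j / r j)) := by
    rw [Finset.sum_comm]
    refine Finset.sum_congr rfl fun i _ => Finset.sum_congr rfl fun j _ => ?_
    rw [tetWeight_comm r t j i]
    ring
  have h3 : ∑ i ∈ t, ∑ j ∈ t,
      tetWeight r t i j * ((y i / r i - y j / r j) * (x i / r i - x j / r j)) =
      ∑ i ∈ t, ∑ j ∈ t, tetWeight r t i j * (y i / r i * (x i / r i - x j / r j)) +
      ∑ i ∈ t, ∑ j ∈ t, tetWeight r t i j * (-(y j / r j) * (x i / r i - x j / r j)) := by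
    simp only [← Finset.sum_add_distrib]
    exact Finset.sum_congr rfl fun i _ => Finset.sum_congr rfl fun j _ => by ring
  rw [h3, ← h2]
  ring

lemma dotProduct_fderiv_curvature_comm (hr : r ∈ T.metrics) (x y : V → ℝ) :
    y ⬝ᵥ fderiv ℝ T.curvature r x = x ⬝ᵥ fderiv ℝ T.curvature r y := by
  rw [dotProduct_fderiv_curvature hr, dotProduct_fderiv_curvature hr]
  simp only [mul_comm]

/-- Angles do not change under scaling: for `x = r` all the quotients `x i / r i` equal one. -/
lemma fderiv_curvature_self (hr : r ∈ T.metrics) : fderiv ℝ T.curvature r r = 0 := by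
  funext i
  rw [fderiv_curvature hr]
  simp [div_self (hr.1 _).ne']

lemma dotProduct_fderiv_curvature_nonneg (hr : r ∈ T.metrics) (x : V → ℝ) :
    0 ≤ x ⬝ᵥ fderiv ℝ T.curvature r x := by
  rw [dotProduct_fderiv_curvature hr]
  simp only [← sq]
  exact mul_nonneg (by norm_num) (Finset.sum_nonneg fun t ht =>
    (tetWeight_form_nonneg_and_eq (T.card_tet t ht) (fun i _ => hr.1 i) (hr.2 t ht)
      (fun i => x i / r i)).1)

/-- The variation of the curvature degenerates only in the direction of scaling. -/
lemma eq_smul_of_dotProduct_fderiv_curvature_eq_zero [ConnectedSpace M] (hr : r ∈ T.metrics)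
    {x : V → ℝ} (hx : x ⬝ᵥ fderiv ℝ T.curvature r x = 0) : ∃ c : ℝ, x = c • r := by
  rw [dotProduct_fderiv_curvature hr] at hx
  simp only [← sq] at hx
  have hform := fun t (ht : t ∈ T.tets) => tetWeight_form_nonneg_and_eq (T.card_tet t ht)
    (fun i _ => hr.1 i) (hr.2 t ht) (fun i => x i / r i)
  have h0 := (Finset.sum_eq_zero_iff_of_nonneg fun t ht => (hform t ht).1).1
    (by simpa using hx)
  obtain ⟨v⟩ := T.nonempty_vertices
  refine ⟨x v / r v, funext fun w => ?_⟩
  have := T.eq_of_eq_on_tets (f := fun i => x i / r i) (fun t ht => (hform t ht).2 (h0 t ht)) v w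
  have hw := (hr.1 w).ne'
  simp only [Pi.smul_apply, smul_eq_mul]
  rw [this, div_mul_cancel₀ _ hw]

/-- Scale invariance gives `∑ j, (∂K_i/∂r_j) r_j = 0`, so the terms in `f i` cancel; the sum may run
over all vertices because `∂K_i/∂r_j` vanishes for distinct non-adjacent `i`, `j`. -/
lemma neg_alphaLaplacian_apply (hr : r ∈ T.metrics) (α : ℝ) (f : V → ℝ) (i : V) :
    (-(T.alphaLaplacian α r)) f i =
      1 / r i ^ α * fderiv ℝ T.curvature r (fun j => r j * f j) i := by
  classical
  have h1 : fderiv ℝ T.curvature r (fun j => r j * f j) i =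
      ∑ j, jacobian T.curvature r i j * r j * (f j - f i) := by
    have h0 : ∑ j, jacobian T.curvature r i j * r j = 0 := by
      have := congrFun (fderiv_curvature_self hr) i
      rwa [← jacobian_mulVec] at this
    rw [← jacobian_mulVec]
    simp only [mul_sub, Finset.sum_sub_distrib]
    rw [← Finset.sum_mul, h0, zero_mul, sub_zero]
    simp only [Matrix.mulVec, dotProduct, mul_assoc]
  rw [h1, LinearMap.neg_apply, Pi.neg_apply]
  change -(1 / r i ^ α * ∑ j with T.Adj j i, (-(jacobian T.curvature r i j) * r j) * (f j - f i))
    = _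
  rw [Finset.sum_filter_of_ne, ← mul_neg, ← Finset.sum_neg_distrib]
  · congr 1
    exact Finset.sum_congr rfl fun j _ => by ring
  · intro j _ hne
    by_contra hadj
    apply hne
    by_cases hji : j = i
    · simp [hji]
    · have : jacobian T.curvature r i j = 0 := by
        rw [jacobian_apply, fderiv_curvature hr, Finset.sum_eq_zero, mul_zero]
        intro t ht
        rw [Finset.mem_filter] at ht
        refine Finset.sum_eq_zero fun k hk => ?_
        have hkj : k ≠ j := fun h => hadj ⟨hji, t, ht.1, h ▸ hk, ht.2⟩
        simp [hkj, Ne.symm hji]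
      simp [this]

/-- The spectral gap of the `α`-Laplacian. -/
lemma firstPositiveEigenvalue_mul_le [ConnectedSpace M] (hr : r ∈ T.metrics) (α : ℝ) {y : V → ℝ}
    (hy : ∑ i, r i ^ α * y i = 0) :
    T.firstPositiveEigenvalue α r * ∑ i, r i ^ (α - 1) * y i ^ 2 ≤
      y ⬝ᵥ fderiv ℝ T.curvature r y := by
  -- The exponent is chosen so that `ρ² r^(α-1) = 1`: then `H = ρ DK ρ` is symmetric and, through `f
  -- = ρ u / r`, similar to `-Δ_α`.
  set ρ : V → ℝ := fun i => r i ^ ((1 - α) / 2) with hρ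
  have hρpos : ∀ i, 0 < ρ i := fun i => Real.rpow_pos_of_pos (hr.1 i) _
  have hρ2 : ∀ i, ρ i ^ 2 * r i ^ (α - 1) = 1 := fun i => by
    rw [← Real.rpow_natCast, ← Real.rpow_mul (hr.1 i).le, ← Real.rpow_add (hr.1 i)]
    rw [show (1 - α) / 2 * ((2 : ℕ) : ℝ) + (α - 1) = 0 by push_cast; ring, Real.rpow_zero]
  have hα : ∀ i, r i ^ α = r i ^ (α - 1) * r i := fun i => by
    rw [← Real.rpow_add_one (hr.1 i).ne', sub_add_cancel]
  set H : Matrix V V ℝ := Matrix.diagonal ρ * jacobian T.curvature r * Matrix.diagonal ρ with hH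
  have hHu : ∀ u i, (H *ᵥ u) i = ρ i * fderiv ℝ T.curvature r (fun j => ρ j * u j) i := by
    intro u i
    rw [hH, ← Matrix.mulVec_mulVec, ← Matrix.mulVec_mulVec, Matrix.mulVec_diagonal,
      jacobian_mulVec]
    have : Matrix.diagonal ρ *ᵥ u = fun j => ρ j * u j :=
      funext fun j => Matrix.mulVec_diagonal _ _ _
    rw [this]
  have hform : ∀ u v, v ⬝ᵥ H *ᵥ u =
      (fun j => ρ j * v j) ⬝ᵥ fderiv ℝ T.curvature r (fun j => ρ j * u j) := by
    intro u v
    simp only [dotProduct, hHu]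
    exact Finset.sum_congr rfl fun i _ => by ring
  have hpsd : H.PosSemidef := by
    refine Matrix.PosSemidef.of_dotProduct_mulVec_nonneg ?_ fun u => ?_
    · ext i j
      have := hform (Pi.single i 1) (Pi.single j 1)
      rw [dotProduct_fderiv_curvature_comm hr, ← hform] at this
      simpa using this
    · rw [star_trivial, hform]
      exact dotProduct_fderiv_curvature_nonneg hr _
  have hker : ∀ u, H *ᵥ u = 0 → u ⬝ᵥ (fun i => y i / ρ i) = 0 := by
    intro u hu
    have h0 := hform u u
    rw [hu, dotProduct_zero] at h0
    obtain ⟨c, hc⟩ := eq_smul_of_dotProduct_fderiv_curvature_eq_zero hr h0.symm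
    have : u ⬝ᵥ (fun i => y i / ρ i) = c * ∑ i, r i ^ α * y i := by
      rw [dotProduct, Finset.mul_sum]
      refine Finset.sum_congr rfl fun i _ => ?_
      have h1 : ρ i * u i = c * r i := congrFun hc i
      have h2 := (hρpos i).ne'
      rw [hα]
      field_simp
      calc u i * y i = u i * y i * (ρ i ^ 2 * r i ^ (α - 1)) := by rw [hρ2, mul_one]
        _ = (ρ i * u i) * (r i ^ (α - 1) * ρ i * y i) := by ring
        _ = _ := by rw [h1]; ring
    rw [this, hy, mul_zero]
  have hlam : ∀ μ > 0, ∀ u ≠ 0, H *ᵥ u = μ • u → T.firstPositiveEigenvalue α r ≤ μ := by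
    intro μ hμ u hu hHμ
    -- Only the lower-bound property of the infimum matters, not that it is attained.
    refine csInf_le ⟨0, fun x hx => hx.1.le⟩ ⟨hμ, ?_⟩
    refine Module.End.hasEigenvalue_of_hasEigenvector (x := fun i => ρ i * u i / r i)
      ⟨Module.End.mem_eigenspace_iff.2 ?_, fun h => hu (funext fun i => ?_)⟩
    · funext i
      rw [neg_alphaLaplacian_apply hr]
      have e : (fun j => r j * (ρ j * u j / r j)) = fun j => ρ j * u j := by
        funext j
        exact mul_div_cancel₀ _ (hr.1 j).ne'
      have h1 := hHu u i
      rw [hHμ, Pi.smul_apply, smul_eq_mul] at h1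
      rw [e, Pi.smul_apply, smul_eq_mul, hα]
      have h2 := (hρpos i).ne'
      have h3 := (hr.1 i).ne'
      have h4 := (Real.rpow_pos_of_pos (hr.1 i) (α - 1)).ne'
      have h5 := hρ2 i
      have h6 : fderiv ℝ T.curvature r (fun j => ρ j * u j) i = μ * u i / ρ i := by
        rw [h1, mul_div_cancel_left₀ _ h2]
      rw [h6]
      field_simp
      linear_combination (-u i) * h5
    · have := congrFun h i
      simpa [(hρpos i).ne', (hr.1 i).ne'] using this
  have main := hpsd.mul_dotProduct_le_of_le_eigenvalue hlam hker
  rw [hform] at main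
  have e1 : (fun j => ρ j * (y j / ρ j)) = y := by
    funext j
    exact mul_div_cancel₀ _ (hρpos j).ne'
  have e2 : (fun i => y i / ρ i) ⬝ᵥ (fun i => y i / ρ i) = ∑ i, r i ^ (α - 1) * y i ^ 2 := by
    refine Finset.sum_congr rfl fun i _ => ?_
    have h2 := (hρpos i).ne'
    field_simp
    linear_combination (-y i ^ 2) * hρ2 i
  rwa [e1, e2] at main

end Triangulation

/-! ### The Jacobian of the flow at constant `α`-curvature -/

namespace Triangulation

variable {V : Type*} [Fintype V] [DecidableEq V] {M : Type*} [TopologicalSpace M]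
  {T : Triangulation V M} {r : V → ℝ}

lemma sum_rpow_pos [Nonempty V] (hr : r ∈ T.metrics) (p : ℝ) : 0 < ∑ i, r i ^ p :=
  Finset.sum_pos (fun i _ => Real.rpow_pos_of_pos (hr.1 i) p) Finset.univ_nonempty

/-- Summing `K_i r_i = c r_i^(α+1)` identifies the constant `c` with `s_α`. -/
lemma curvature_eq_sAlpha_mul [Nonempty V] (hr : r ∈ T.metrics) {α : ℝ}
    (hconst : T.IsConstAlphaCurvature α r) (i : V) :
    T.curvature r i = T.sAlpha α r * r i ^ α := by
  obtain ⟨c, hc⟩ := hconst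
  have h : ∀ i, T.curvature r i = c * r i ^ α := fun i =>
    (div_eq_iff (Real.rpow_pos_of_pos (hr.1 i) α).ne').1 (hc i)
  have hs : T.sAlpha α r = c := by
    rw [sAlpha, div_eq_iff (sum_rpow_pos hr _).ne', totalCurvature, Finset.mul_sum]
    refine Finset.sum_congr rfl fun i _ => ?_
    rw [h, Real.rpow_add_one (hr.1 i).ne', mul_assoc]
  rw [h, hs]

/-- The derivative of the `α`-flow field at a metric of constant `α`-curvature. -/
lemma flowField_hasFDerivAt [Nonempty V] (hr : r ∈ T.metrics) {α : ℝ}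
    (hconst : T.IsConstAlphaCurvature α r) :
    DifferentiableAt ℝ (T.flowField α) r ∧
    ∀ x i, fderiv ℝ (T.flowField α) r x i = α * T.sAlpha α r * (r i ^ (α - 1) * x i -
      (∑ j, r j ^ α * x j) / (∑ j, r j ^ (α + 1)) * r i ^ α) - fderiv ℝ T.curvature r x i := by
  have hpow : ∀ (p : ℝ) (i : V), HasFDerivAt (fun r' : V → ℝ => r' i ^ p)
      ((p * r i ^ (p - 1)) • ContinuousLinearMap.proj (R := ℝ) (φ := fun _ : V => ℝ) i) r :=
    fun p i => (hasFDerivAt_apply i r).rpow_const (Or.inl (hr.1 i).ne')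
  have hK : ∀ i, HasFDerivAt (fun r' => T.curvature r' i)
      ((ContinuousLinearMap.proj i).comp (fderiv ℝ T.curvature r)) r :=
    hasFDerivAt_pi'.1 (hasFDerivAt_curvature hr).differentiableAt.hasFDerivAt
  have hA0 := (sum_rpow_pos hr (α + 1)).ne'
  have hS : HasFDerivAt T.totalCurvature _ r :=
    HasFDerivAt.fun_sum (u := Finset.univ) fun i _ => (hK i).mul (hasFDerivAt_apply i r)
  have hA : HasFDerivAt (fun r' : V → ℝ => ∑ i, r' i ^ (α + 1)) _ r :=
    HasFDerivAt.fun_sum (u := Finset.univ) fun i _ => hpow (α + 1) i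
  have hs : HasFDerivAt (T.sAlpha α) _ r :=
    hS.mul ((hasDerivAt_inv hA0).comp_hasFDerivAt r hA)
  have hflow : HasFDerivAt (T.flowField α) (ContinuousLinearMap.pi fun i => _) r :=
    hasFDerivAt_pi.2 fun i => (hs.mul (hpow α i)).sub (hK i)
  refine ⟨hflow.differentiableAt, fun x i => ?_⟩
  rw [hflow.fderiv]
  simp only [ContinuousLinearMap.coe_pi', sub_apply, add_apply, smul_apply, smul_eq_mul,
    sum_apply, ContinuousLinearMap.proj_apply, ContinuousLinearMap.comp_apply]
  have e0 : ∑ j, (T.curvature r j * x j + r j * fderiv ℝ T.curvature r x j) =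
      T.sAlpha α r * ∑ j, r j ^ α * x j := by
    -- A Schläfli-type identity, from symmetry and scale invariance: the gradient of `S` is `K`.
    -- Hence the derivative of `s_α` is `(1 - (α + 1)) s_α ∑ r_j^α x_j / ∑ r_j^(α+1)`.
    have h : ∑ j, r j * fderiv ℝ T.curvature r x j = 0 := by
      have := dotProduct_fderiv_curvature_comm hr x r
      rwa [fderiv_curvature_self hr, dotProduct_zero] at this
    rw [Finset.sum_add_distrib, h, add_zero, Finset.mul_sum]
    exact Finset.sum_congr rfl fun j _ => by rw [curvature_eq_sAlpha_mul hr hconst]; ring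
  have e1 : ∑ j, (α + 1) * r j ^ (α + 1 - 1) * x j = (α + 1) * ∑ j, r j ^ α * x j := by
    rw [Finset.mul_sum]
    exact Finset.sum_congr rfl fun j _ => by rw [add_sub_cancel_right]; ring
  have e2 : T.totalCurvature r = T.sAlpha α r * ∑ j, r j ^ (α + 1) := by
    rw [sAlpha, div_mul_cancel₀ _ hA0]
  rw [e0, e1, e2]
  field_simp
  ring

/-- The Hessian form of the `α`-flow at a metric of constant `α`-curvature. -/
lemma dotProduct_fderiv_flowField [Nonempty V] (hr : r ∈ T.metrics) {α : ℝ}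
    (hconst : T.IsConstAlphaCurvature α r) (x y : V → ℝ) :
    y ⬝ᵥ (-jacobian (T.flowField α) r) *ᵥ x = y ⬝ᵥ fderiv ℝ T.curvature r x -
      α * T.sAlpha α r * (∑ i, r i ^ (α - 1) * (x i * y i) -
        (∑ i, r i ^ α * x i) * (∑ i, r i ^ α * y i) / ∑ i, r i ^ (α + 1)) := by
  rw [Matrix.neg_mulVec, jacobian_mulVec]
  have h : (∑ i, r i ^ α * x i) * (∑ i, r i ^ α * y i) / ∑ i, r i ^ (α + 1) =
      ∑ i, y i * ((∑ j, r j ^ α * x j) / (∑ j, r j ^ (α + 1)) * r i ^ α) := by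
    rw [mul_div_right_comm, Finset.mul_sum]
    exact Finset.sum_congr rfl fun i _ => by ring
  rw [h, ← Finset.sum_sub_distrib, Finset.mul_sum, dotProduct, dotProduct,
    ← Finset.sum_sub_distrib]
  refine Finset.sum_congr rfl fun i _ => ?_
  rw [Pi.neg_apply, (flowField_hasFDerivAt hr hconst).2]
  ring

lemma jacobian_flowField_mulVec_self [Nonempty V] (hr : r ∈ T.metrics) {α : ℝ}
    (hconst : T.IsConstAlphaCurvature α r) : (-jacobian (T.flowField α) r) *ᵥ r = 0 := by
  have hα : ∀ i, r i ^ α * r i = r i ^ (α + 1) := fun i =>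
    (Real.rpow_add_one (hr.1 i).ne' α).symm
  have hα' : ∀ i, r i ^ (α - 1) * r i = r i ^ α := fun i => by
    rw [← Real.rpow_add_one (hr.1 i).ne', sub_add_cancel]
  funext i
  rw [Matrix.neg_mulVec, jacobian_mulVec, Pi.neg_apply, (flowField_hasFDerivAt hr hconst).2,
    fderiv_curvature_self hr]
  simp only [hα, hα', div_self (sum_rpow_pos hr (α + 1)).ne']
  simp

lemma jacobian_flowField_isSymm [Nonempty V] (hr : r ∈ T.metrics) {α : ℝ}
    (hconst : T.IsConstAlphaCurvature α r) (x y : V → ℝ) :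
    y ⬝ᵥ (-jacobian (T.flowField α) r) *ᵥ x = x ⬝ᵥ (-jacobian (T.flowField α) r) *ᵥ y := by
  rw [dotProduct_fderiv_flowField hr hconst, dotProduct_fderiv_flowField hr hconst,
    dotProduct_fderiv_curvature_comm hr, mul_comm (∑ i, r i ^ α * x i)]
  simp only [mul_comm (x _)]

/-- The coercivity of the Hessian form transversally to scaling. -/
lemma gap_mul_le_dotProduct_fderiv_flowField [ConnectedSpace M] [Nonempty V] (hr : r ∈ T.metrics)
    {α : ℝ} (hconst : T.IsConstAlphaCurvature α r) (x : V → ℝ) :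
    ∃ c : ℝ, (T.firstPositiveEigenvalue α r - α * T.sAlpha α r) *
      ∑ i, r i ^ (α - 1) * (x i - c * r i) ^ 2 ≤
        x ⬝ᵥ (-jacobian (T.flowField α) r) *ᵥ x := by
  have hA0 := (sum_rpow_pos hr (α + 1)).ne'
  -- The coefficient of the projection of `x` to `r` for the inner product with weights `r i ^ (α -
  -- 1)`.
  set c := (∑ i, r i ^ α * x i) / ∑ i, r i ^ (α + 1) with hc
  refine ⟨c, ?_⟩
  set y : V → ℝ := x - c • r with hy
  have hyi : ∀ i, y i = x i - c * r i := fun i => rfl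
  have hy0 : ∑ i, r i ^ α * y i = 0 := by
    have : ∀ i, r i ^ α * y i = r i ^ α * x i - c * r i ^ (α + 1) := fun i => by
      rw [hyi, Real.rpow_add_one (hr.1 i).ne']; ring
    simp only [this, Finset.sum_sub_distrib, ← Finset.mul_sum]
    rw [hc, div_mul_cancel₀ _ hA0, sub_self]
  have hx : x ⬝ᵥ (-jacobian (T.flowField α) r) *ᵥ x =
      y ⬝ᵥ (-jacobian (T.flowField α) r) *ᵥ y := by
    have hMr := jacobian_flowField_mulVec_self hr hconst
    have h1 : (-jacobian (T.flowField α) r) *ᵥ y = (-jacobian (T.flowField α) r) *ᵥ x := by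
      rw [hy, Matrix.mulVec_sub, Matrix.mulVec_smul, hMr, smul_zero, sub_zero]
    rw [h1, jacobian_flowField_isSymm hr hconst x y, h1]
  have hgap := firstPositiveEigenvalue_mul_le hr α hy0
  rw [hx, dotProduct_fderiv_flowField hr hconst, hy0]
  simp only [← hyi, ← sq]
  simp only [ne_eq, OfNat.ofNat_ne_zero, not_false_eq_true, zero_pow, zero_div, sub_zero]
  linarith

end Triangulation

theorem mainTheorem7 {V : Type*} [Fintype V] [DecidableEq V]
    {M : Type*} [TopologicalSpace M] [T2Space M] [CompactSpace M] [ConnectedSpace M]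
    [ChartedSpace (EuclideanSpace ℝ (Fin 3)) M]
    (T : Triangulation V M) (α : ℝ) (r : V → ℝ) (hr : r ∈ T.metrics)
    (hconst : T.IsConstAlphaCurvature α r)
    (heig : α * T.sAlpha α r < T.firstPositiveEigenvalue α r) :
    DifferentiableAt ℝ (T.flowField α) r ∧
      (-jacobian (T.flowField α) r).PosSemidef ∧
      (-jacobian (T.flowField α) r).rank + 1 = Fintype.card V ∧
      LinearMap.ker (-jacobian (T.flowField α) r).mulVecLin = Submodule.span ℝ {r} := by
  have hV : Nonempty V := T.nonempty_vertices
  have hpos : ∀ (c : ℝ) (x : V → ℝ) i, 0 ≤ r i ^ (α - 1) * (x i - c * r i) ^ 2 := fun c x i =>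
    mul_nonneg (Real.rpow_pos_of_pos (hr.1 i) _).le (sq_nonneg _)
  have hker : LinearMap.ker (-jacobian (T.flowField α) r).mulVecLin = Submodule.span ℝ {r} := by
    refine le_antisymm (fun x hx => ?_) ?_
    · rw [LinearMap.mem_ker, Matrix.mulVecLin_apply] at hx
      obtain ⟨c, hc⟩ := T.gap_mul_le_dotProduct_fderiv_flowField hr hconst x
      rw [hx, dotProduct_zero] at hc
      -- On the kernel, coercivity bounds a positive multiple of this nonnegative sum by zero.
      have h0 : ∑ i, r i ^ (α - 1) * (x i - c * r i) ^ 2 = 0 :=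
        le_antisymm (nonpos_of_mul_nonpos_right hc (sub_pos.2 heig))
          (Finset.sum_nonneg fun i _ => hpos c x i)
      refine Submodule.mem_span_singleton.2 ⟨c, funext fun i => ?_⟩
      have := (Finset.sum_eq_zero_iff_of_nonneg fun i _ => hpos c x i).1 h0 i (Finset.mem_univ i)
      rw [mul_eq_zero, or_iff_right (Real.rpow_pos_of_pos (hr.1 i) _).ne', sq_eq_zero_iff,
        sub_eq_zero] at this
      exact this.symm
    · rw [Submodule.span_singleton_le_iff_mem, LinearMap.mem_ker, Matrix.mulVecLin_apply]
      exact Triangulation.jacobian_flowField_mulVec_self hr hconst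
  refine ⟨(Triangulation.flowField_hasFDerivAt hr hconst).1, ?_, ?_, hker⟩
  · refine Matrix.PosSemidef.of_dotProduct_mulVec_nonneg ?_ fun x => ?_
    · ext i j
      have := Triangulation.jacobian_flowField_isSymm hr hconst (Pi.single i 1) (Pi.single j 1)
      simpa using this
    · rw [star_trivial]
      obtain ⟨c, hc⟩ := T.gap_mul_le_dotProduct_fderiv_flowField hr hconst x
      exact (mul_nonneg (sub_pos.2 heig).le (Finset.sum_nonneg fun i _ => hpos c x i)).trans hc
  · have hr0 : r ≠ 0 := fun h => (hr.1 hV.some).ne' (congrFun h _)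
    have := LinearMap.finrank_range_add_finrank_ker (-jacobian (T.flowField α) r).mulVecLin
    rwa [hker, finrank_span_singleton hr0, Module.finrank_pi] at this
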